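/- Let $\mathbb K=\mathbb R$ or $\mathbb C$ and let $w$ be the set of all sequences $x=(x_n)_{n\ge0}$ in $\mathbb K$. Let $l_\infty$, $c$, $c_0\subset w$ be the sets of bounded, convergent and null sequences. Let $r,s,t\in w$ with $r_n\ne0$ and $t_n\neq 0$ for all $n\ge 0$, and $s_0\ne0$. For $X\in\{l_\infty,c,c_0\}$ put $$X(r,s,t;\Delta)=\Big\{x\in w:\Big(\frac1{r_n}\sum_{k=0}^n s_{n-k}t_k(x_k-x_{k-1})\Big)_{n\ge0}\in X\Big\},\qquad x_{-1}:=0 .$$ For $U\subset w$ the $\beta$-dual is $U^\beta=\{a\in w:\ \sum_{n=0}^\infty a_nu_n \text{ converges for every } u\in U\}$. Put $D^{(s)}_0=1/s_0$ and, for $n\ge1$, $$D^{(s)}_n=\frac1{s_0^{\,n+1}}\det\big(s_{i-j+1}\big)_{1\le i,j\le n},\qquad s_{p}:=0\ \text{ for } p<0 .$$ For $a\in w$ let $$R_k(a)=\lim_{M\to\infty} r_k\Big[\frac{a_k}{s_0t_k}+\Big(\frac{D^{(s)}_0}{t_k}-\frac{D^{(s)}_1}{t_{k+1}}\Big)\sum_{j=k+1}^{M}a_j+\sum_{l=2}^{M-k}(-1)^l\frac{D^{(s)}_l}{t_{l+k}}\sum_{j=k+l}^{M}a_j\Big]\qquad(k\ge0),$$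 $$w_{mk}=\lim_{M\to\infty} r_k\Big[\sum_{l=0}^{m-k}(-1)^l\frac{D^{(s)}_l}{t_{l+k}}\sum_{j=m}^{M}a_j+\sum_{l=m-k+1}^{M-k}(-1)^l\frac{D^{(s)}_l}{t_{l+k}}\sum_{j=k+l}^{M}a_j\Big]\qquad(0\le k\le m),$$ and $w_{mk}=0$ for $k>m$. (Equivalently, $R_k(a)=\sum_{j=k}^\infty a_js_{jk}$ and $w_{mk}=\sum_{j=m}^\infty a_js_{jk}$ for $k\le m$, where $s_{jk}=r_k\sum_{l=0}^{j-k}(-1)^lD^{(s)}_l/t_{l+k}$ for $k\le j$.) Consider the following sets, where membership in $B_1$ includes that all the $R_k(a)$ exist, and membership in each of $B_2,\dots,B_6$ includes that all the $w_{mk}$ exist (as finite limits): $$\begin{aligned} B_1&=\Big\{a\in w:\sum_{k=0}^\infty|R_k(a)|<\infty\Big\}, & B_2&=\Big\{a\in w:\lim_{m\to\infty}w_{mk}=0\text{ for all }k\Big\},\\ B_3&=\Big\{a\in w:\sup_m\sum_{k=0}^\infty|w_{mk}|<\infty\Big\}, & B_4&=\Big\{a\in w:\lim_{m\to\infty}\sum_{k=0}^m|w_{mk}|=0\Big\},\\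 B_5&=\Big\{a\in w:\lim_{m\to\infty}w_{mk}\text{ exists for all }k\Big\}, & B_6&=\Big\{a\in w:\lim_{m\to\infty}\sum_{k=0}^m w_{mk}\text{ exists}\Big\}. \end{aligned}$$ Then $$[c_0(r,s,t;\Delta)]^\beta=B_1\cap B_2\cap B_3,\qquad [l_\infty(r,s,t;\Delta)]^\beta=B_1\cap B_4,\qquad [c(r,s,t;\Delta)]^\beta=B_1\cap B_3\cap B_5\cap B_6 .$$ -/

import Mathlib

open Filter Topology

namespace GenMeans

variable {𝕜 : Type*} [RCLike 𝕜]

/-- The space of null sequences. -/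
def c0 (𝕜 : Type*) [RCLike 𝕜] : Set (ℕ → 𝕜) := {x | Tendsto x atTop (𝓝 0)}

/-- The space of convergent sequences. -/
def c (𝕜 : Type*) [RCLike 𝕜] : Set (ℕ → 𝕜) := {x | ∃ l, Tendsto x atTop (𝓝 l)}

/-- The space of bounded sequences. -/
def linf (𝕜 : Type*) [RCLike 𝕜] : Set (ℕ → 𝕜) := {x | BddAbove (Set.range fun n => ‖x n‖)}

/-- The space of convergent (not necessarily absolutely convergent) series. -/
def cs (𝕜 : Type*) [RCLike 𝕜] : Set (ℕ → 𝕜) :=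
  {x | ∃ l, Tendsto (fun n => ∑ k ∈ Finset.range n, x k) atTop (𝓝 l)}

/-- The multiplier space of two sets of sequences. -/
def multiplier (U V : Set (ℕ → 𝕜)) : Set (ℕ → 𝕜) := {a | ∀ u ∈ U, (fun n => a n * u n) ∈ V}

/-- The beta-dual of a set of sequences. -/
def betaDual (U : Set (ℕ → 𝕜)) : Set (ℕ → 𝕜) := multiplier U (cs 𝕜)

/-- The backward difference, with the convention that the term of index `-1` is zero. -/
def diff (x : ℕ → 𝕜) : ℕ → 𝕜
  | 0 => x 0
  | k + 1 => x (k + 1) - x k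

/-- The generalized means of a sequence. -/
def genMean (r s t x : ℕ → 𝕜) (n : ℕ) : 𝕜 :=
  1 / r n * ∑ k ∈ Finset.range (n + 1), s (n - k) * t k * x k

/-- The space `X(r, s, t; Δ)`. -/
def space (X : Set (ℕ → 𝕜)) (r s t : ℕ → 𝕜) : Set (ℕ → 𝕜) := {x | genMean r s t (diff x) ∈ X}

/-- The `n × n` Hessenberg matrix with rows `(s₁, s₀, 0, …)`, `(s₂, s₁, s₀, 0, …)`, …,
`(sₙ, …, s₁)`. -/
def hessenberg (s : ℕ → 𝕜) (n : ℕ) : Matrix (Fin n) (Fin n) 𝕜 :=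
  Matrix.of fun i j => if (j : ℕ) ≤ i + 1 then s (i + 1 - j) else 0

/-- The number `Dₙ`; for `n = 0` the determinant is that of the empty matrix, so `D₀ = 1 / s₀`. -/
noncomputable def D (s : ℕ → 𝕜) (n : ℕ) : 𝕜 := 1 / s 0 ^ (n + 1) * (hessenberg s n).det

/-- The expression defining `R_k(a)`, with all the series in it cut off at the index `M` of `a`
(relevant for `k ≤ M`). -/
noncomputable def RTrunc (r s t a : ℕ → 𝕜) (k M : ℕ) : 𝕜 :=
  r k * (a k / (s 0 * t k)
    + (D s 0 / t k - D s 1 / t (k + 1)) * ∑ j ∈ Finset.Icc (k + 1) M, a j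
    + ∑ l ∈ Finset.Icc 2 (M - k),
        (-1) ^ l * (D s l / t (l + k)) * ∑ j ∈ Finset.Icc (k + l) M, a j)

/-- The expression defining `w_{mk}`, `k ≤ m`, with all the series in it cut off at the index `M`
of `a` (relevant for `m ≤ M`). -/
noncomputable def wTrunc (r s t a : ℕ → 𝕜) (m k M : ℕ) : 𝕜 :=
  r k * ((∑ l ∈ Finset.Icc 0 (m - k), (-1) ^ l * (D s l / t (l + k)))
        * (∑ j ∈ Finset.Icc m M, a j)
    + ∑ l ∈ Finset.Icc (m - k + 1) (M - k),
        (-1) ^ l * (D s l / t (l + k)) * ∑ j ∈ Finset.Icc (k + l) M, a j)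

/-- `R_k(a)` exists for every `k`, and `(R_k(a))_k` is the sequence `R`. -/
def IsR (r s t a R : ℕ → 𝕜) : Prop :=
  ∀ k, Tendsto (fun M => RTrunc r s t a k M) atTop (𝓝 (R k))

/-- `w_{mk}` exists for all `k ≤ m`, and `w` is the triangular matrix `(w_{mk})`. -/
def IsW (r s t a : ℕ → 𝕜) (w : ℕ → ℕ → 𝕜) : Prop :=
  (∀ m k, k ≤ m → Tendsto (fun M => wTrunc r s t a m k M) atTop (𝓝 (w m k))) ∧
    ∀ m k, m < k → w m k = 0

def B₁ (r s t : ℕ → 𝕜) : Set (ℕ → 𝕜) :=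
  {a | ∃ R, IsR r s t a R ∧ Summable fun k => ‖R k‖}

def B₂ (r s t : ℕ → 𝕜) : Set (ℕ → 𝕜) :=
  {a | ∃ w, IsW r s t a w ∧ ∀ k, Tendsto (fun m => w m k) atTop (𝓝 0)}

/-- The series over `k` has only finitely many nonzero terms, since `w` is triangular. -/
def B₃ (r s t : ℕ → 𝕜) : Set (ℕ → 𝕜) :=
  {a | ∃ w, IsW r s t a w ∧ BddAbove (Set.range fun m => ∑' k, ‖w m k‖)}

def B₄ (r s t : ℕ → 𝕜) : Set (ℕ → 𝕜) :=
  {a | ∃ w, IsW r s t a w ∧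
    Tendsto (fun m => ∑ k ∈ Finset.range (m + 1), ‖w m k‖) atTop (𝓝 0)}

def B₅ (r s t : ℕ → 𝕜) : Set (ℕ → 𝕜) :=
  {a | ∃ w, IsW r s t a w ∧ ∀ k, ∃ l, Tendsto (fun m => w m k) atTop (𝓝 l)}

def B₆ (r s t : ℕ → 𝕜) : Set (ℕ → 𝕜) :=
  {a | ∃ w, IsW r s t a w ∧
    ∃ l, Tendsto (fun m => ∑ k ∈ Finset.range (m + 1), w m k) atTop (𝓝 l)}

end GenMeans

/-!
Write `s_{nk}` for the entries of the triangle inverse to `x ↦ genMean r s t (diff x)`; the numbers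
`(-1)ⁿ Dₙ` in it are the coefficients of the reciprocal of the power series with coefficients `s`.
Then `∑_{n < N} aₙ xₙ = ∑ₖ (∑_{k ≤ n < N} aₙ s_{nk}) yₖ`, where `y` is the mean of `x`, so that
`a` lies in the `β`-dual iff the matrix of these inner sums maps `X` into `c`. As `X ⊇ c₀`, the
columns of that matrix must converge, to an absolutely summable sequence `R(a)`; subtracting it
leaves the matrix `-w`, whose columns tend to zero, and the theorems of Kojima–Schur (for `c₀` and
`c`) and Schur (for `l∞`) say when `w` maps `X` into `c`.
-/

namespace GenMeans

open Finset Set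

section Hessenberg

variable {A : Type*} [CommRing A]

/-- The Hessenberg matrix of `s` with its first column replaced by `v`. These matrices, unlike
those of the form `hessenberg s n`, are stable under expansion of the determinant along the first
row. -/
def borderedHessenberg (s v : ℕ → A) (n : ℕ) : Matrix (Fin n) (Fin n) A :=
  Matrix.of fun i j =>
    if (j : ℕ) = 0 then v i else if (j : ℕ) ≤ i + 1 then s (i + 1 - j) else 0

theorem det_borderedHessenberg_succ_succ (s v : ℕ → A) (n : ℕ) :
    (borderedHessenberg s v (n + 2)).det =
      v 0 * (borderedHessenberg s (fun i => s (i + 1)) (n + 1)).det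
        - s 0 * (borderedHessenberg s (fun i => v (i + 1)) (n + 1)).det := by
  have minor_zero : (borderedHessenberg s v (n + 2)).submatrix Fin.succ (Fin.succAbove 0) =
      borderedHessenberg s (fun i => s (i + 1)) (n + 1) := by
    ext i j
    rcases eq_or_ne j 0 with rfl | hj <;> simp [borderedHessenberg, *]
  have minor_one : (borderedHessenberg s v (n + 2)).submatrix Fin.succ (Fin.succAbove 1) =
      borderedHessenberg s (fun i => v (i + 1)) (n + 1) := by
    ext i j
    refine Fin.cases ?_ (fun j => ?_) j
    · simp [borderedHessenberg]
    · have : Fin.succAbove (1 : Fin (n + 2)) j.succ = j.succ.succ := by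
        rw [← Fin.succ_zero_eq_one, Fin.succ_succAbove_succ, Fin.succAbove_zero]
      simp [borderedHessenberg, this]
  have entry_zero : borderedHessenberg s v (n + 2) 0 0 = v 0 := by simp [borderedHessenberg]
  have entry_one : borderedHessenberg s v (n + 2) 0 1 = s 0 := by simp [borderedHessenberg]
  rw [Matrix.det_succ_row_zero, Fin.sum_univ_succ, Fin.sum_univ_succ,
    Finset.sum_eq_zero fun j _ => by simp [borderedHessenberg],
    Fin.succ_zero_eq_one, minor_zero, minor_one, entry_zero, entry_one, Fin.val_zero, Fin.val_one]
  ring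

theorem det_borderedHessenberg_succ (s v : ℕ → A) (n : ℕ) :
    (borderedHessenberg s v (n + 1)).det = ∑ j ∈ range (n + 1),
      (-s 0) ^ j * v j * (borderedHessenberg s (fun i => s (i + 1)) (n - j)).det := by
  induction n generalizing v with
  | zero => simp [borderedHessenberg]
  | succ n ih =>
    rw [det_borderedHessenberg_succ_succ, ih (fun i => v (i + 1)), sum_range_succ' _ (n + 1),
      mul_sum, sub_eq_neg_add, ← sum_neg_distrib, pow_zero, one_mul, Nat.sub_zero]
    refine congrArg (· + _) (sum_congr rfl fun j _ => ?_)
    rw [Nat.add_sub_add_right]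
    ring

theorem mk_mul_mk_eq_mk_iff {p q z : ℕ → A} :
    PowerSeries.mk p * PowerSeries.mk q = PowerSeries.mk z ↔
      ∀ n, ∑ k ∈ range (n + 1), p (n - k) * q k = z n := by
  rw [PowerSeries.ext_iff]
  refine forall_congr' fun n => ?_
  rw [mul_comm, PowerSeries.coeff_mul, Nat.sum_antidiagonal_eq_sum_range_succ_mk]
  simp only [PowerSeries.coeff_mk, mul_comm]

theorem convolution_eq_iff_of_mk_mul_mk_eq_one {p q : ℕ → A}
    (h : PowerSeries.mk p * PowerSeries.mk q = 1) (u v : ℕ → A) :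
    (∀ n, ∑ k ∈ range (n + 1), p (n - k) * u k = v n) ↔
      ∀ n, ∑ k ∈ range (n + 1), q (n - k) * v k = u n := by
  rw [← mk_mul_mk_eq_mk_iff, ← mk_mul_mk_eq_mk_iff]
  constructor <;> intro e <;> rw [← e, ← mul_assoc]
  · rw [mul_comm (PowerSeries.mk q), h, one_mul]
  · rw [h, one_mul]

end Hessenberg

section Inversion

variable {𝕜 : Type*} [RCLike 𝕜]

theorem hessenberg_eq_borderedHessenberg (s : ℕ → 𝕜) (n : ℕ) :
    hessenberg s n = borderedHessenberg s (fun i => s (i + 1)) n := by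
  ext i j
  by_cases h : (j : ℕ) = 0 <;> simp [borderedHessenberg, hessenberg, h]

/-- The coefficients of the reciprocal of the power series with coefficients `s`. -/
noncomputable def invCoeff (s : ℕ → 𝕜) (n : ℕ) : 𝕜 := (-1) ^ n * D s n

theorem mul_invCoeff_succ {s : ℕ → 𝕜} (hs : s 0 ≠ 0) (n : ℕ) :
    s 0 * invCoeff s (n + 1) = -∑ j ∈ range (n + 1), s (j + 1) * invCoeff s (n - j) := by
  rw [invCoeff, D, hessenberg_eq_borderedHessenberg, det_borderedHessenberg_succ, mul_sum, mul_sum,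
    mul_sum, ← sum_neg_distrib]
  refine sum_congr rfl fun j hj => ?_
  obtain ⟨p, rfl⟩ := Nat.exists_eq_add_of_le (Nat.lt_succ_iff.mp (Finset.mem_range.mp hj))
  have sign : (-1 : 𝕜) ^ (j * 2) = 1 := Even.neg_one_pow (even_two.mul_left j)
  rw [Nat.add_sub_cancel_left, invCoeff, D, hessenberg_eq_borderedHessenberg, neg_pow (s 0)]
  generalize (borderedHessenberg s (fun i => s (i + 1)) p).det = d
  field_simp
  linear_combination -s 0 ^ (j + p + 2) * s (j + 1) * d * (-1) ^ p * sign

theorem mk_mul_mk_invCoeff {s : ℕ → 𝕜} (hs : s 0 ≠ 0) :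
    PowerSeries.mk s * PowerSeries.mk (invCoeff s) = 1 := by
  ext n
  rw [PowerSeries.coeff_mul, Nat.sum_antidiagonal_eq_sum_range_succ_mk]
  cases n with
  | zero => simp [invCoeff, D, hs]
  | succ n =>
    rw [sum_range_succ']
    simp [mul_invCoeff_succ hs, PowerSeries.coeff_one]

theorem sum_range_succ_diff (x : ℕ → 𝕜) (n : ℕ) : ∑ k ∈ range (n + 1), diff x k = x n := by
  induction n with
  | zero => simp [diff]
  | succ n ih => rw [sum_range_succ, ih, diff, add_sub_cancel]

theorem diff_eq_iff {x d : ℕ → 𝕜} :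
    (∀ n, diff x n = d n) ↔ ∀ n, x n = ∑ k ∈ range (n + 1), d k := by
  constructor
  · intro h n
    simp only [← sum_range_succ_diff x n, h]
  · rintro h (_ | n)
    · simp [diff, h 0]
    · rw [diff, h, h, sum_range_succ _ (n + 1), add_sub_cancel_left]

/-- The entries `s_{nk}`, for `k ≤ n`, of the triangle inverse to `x ↦ genMean r s t (diff x)`. -/
noncomputable def invMeanMatrix (r s t : ℕ → 𝕜) (n k : ℕ) : 𝕜 :=
  r k * ∑ l ∈ Finset.Icc 0 (n - k), (-1) ^ l * (D s l / t (l + k))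

/-- The inverse of `x ↦ genMean r s t (diff x)`. -/
noncomputable def invMean (r s t y : ℕ → 𝕜) (n : ℕ) : 𝕜 :=
  ∑ k ∈ range (n + 1), invMeanMatrix r s t n k * y k

theorem invMean_eq_sum_convolution (r s t y : ℕ → 𝕜) (n : ℕ) :
    invMean r s t y n = ∑ j ∈ range (n + 1),
      (∑ k ∈ range (j + 1), invCoeff s (j - k) * (r k * y k)) / t j := by
  simp only [sum_div]
  rw [Finset.sum_comm' (t' := range (n + 1)) (s' := fun k => Finset.Ico k (n + 1))
    (by intro j k; simp only [Finset.mem_range, Finset.mem_Ico]; omega)]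
  refine sum_congr rfl fun k hk => ?_
  have hk : k ≤ n := Nat.lt_succ_iff.mp (Finset.mem_range.mp hk)
  rw [sum_Ico_eq_sum_range, invMeanMatrix, mul_sum, sum_mul, ← Nat.range_succ_eq_Icc_zero,
    Nat.sub_add_comm hk]
  refine sum_congr rfl fun l _ => ?_
  rw [Nat.add_sub_cancel_left, invCoeff, add_comm k l]
  ring

theorem genMean_diff_eq_iff {r s t : ℕ → 𝕜} (hr : ∀ n, r n ≠ 0) (hs : s 0 ≠ 0)
    (ht : ∀ n, t n ≠ 0) {x y : ℕ → 𝕜} :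
    genMean r s t (diff x) = y ↔ x = invMean r s t y := by
  calc genMean r s t (diff x) = y
      ↔ ∀ n, ∑ k ∈ range (n + 1), s (n - k) * (t k * diff x k) = r n * y n := by
        simp only [funext_iff, genMean, one_div, inv_mul_eq_iff_eq_mul₀ (hr _), mul_assoc]
    _ ↔ ∀ n, ∑ k ∈ range (n + 1), invCoeff s (n - k) * (r k * y k) = t n * diff x n :=
        convolution_eq_iff_of_mk_mul_mk_eq_one (mk_mul_mk_invCoeff hs) _ _
    _ ↔ ∀ n, diff x n = (∑ k ∈ range (n + 1), invCoeff s (n - k) * (r k * y k)) / t n := by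
        simp only [eq_div_iff (ht _), mul_comm (diff x _), eq_comm]
    _ ↔ x = invMean r s t y := by
        rw [diff_eq_iff, funext_iff]
        simp only [invMean_eq_sum_convolution]

end Inversion

section AbsolutelySummable

theorem summable_and_tsum_norm_le_of_tendsto {ι α E : Type*} [NormedAddCommGroup E]
    {F : Filter α} [F.NeBot] {A : α → ι → E} {R : ι → E} {b : α → ℝ} {β : ℝ}
    (hA : ∀ n, Summable fun k => ‖A n k‖) (hR : ∀ k, Tendsto (fun n => A n k) F (𝓝 (R k)))
    (hAb : ∀ᶠ n in F, ∑' k, ‖A n k‖ ≤ b n) (hb : Tendsto b F (𝓝 β)) :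
    (Summable fun k => ‖R k‖) ∧ ∑' k, ‖R k‖ ≤ β := by
  have sum_le (S : Finset ι) : ∑ k ∈ S, ‖R k‖ ≤ β := by
    refine le_of_tendsto_of_tendsto (tendsto_finsetSum S fun k _ => (hR k).norm) hb ?_
    filter_upwards [hAb] with n hn
    exact ((hA n).sum_le_tsum S fun _ _ => norm_nonneg _).trans hn
  exact ⟨summable_of_sum_le (fun _ => norm_nonneg _) sum_le,
    Real.tsum_le_of_sum_le (fun _ => norm_nonneg _) sum_le⟩

/-- Osgood's theorem: pointwise convergence of continuous functions is nearly uniform on some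
nonempty open set. -/
theorem exists_isOpen_forall_dist_le_of_cauchySeq {Y E : Type*} [TopologicalSpace Y] [BaireSpace Y]
    [Nonempty Y] [PseudoMetricSpace E] {f : ℕ → Y → E} (hf : ∀ n, Continuous (f n))
    (h : ∀ y, CauchySeq fun n => f n y) {ε : ℝ} (hε : 0 < ε) :
    ∃ U : Set Y, IsOpen U ∧ U.Nonempty ∧
      ∃ m, ∀ p ≥ m, ∀ q ≥ m, ∀ y ∈ U, dist (f p y) (f q y) ≤ ε := by
  let F : ℕ → Set Y := fun m => {y | ∀ p ≥ m, ∀ q ≥ m, dist (f p y) (f q y) ≤ ε}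
  have hF (m : ℕ) : IsClosed (F m) := by
    simp only [F, Set.ofPred_forall]
    exact isClosed_iInter fun p => isClosed_iInter fun _ => isClosed_iInter fun q =>
      isClosed_iInter fun _ => isClosed_le ((hf p).dist (hf q)) continuous_const
  have hU : ⋃ m, F m = Set.univ := by
    refine Set.eq_univ_of_forall fun y => Set.mem_iUnion.mpr ?_
    obtain ⟨m, hm⟩ := Metric.cauchySeq_iff.mp (h y) ε hε
    exact ⟨m, fun p hp q hq => (hm p hp q hq).le⟩
  obtain ⟨m, hm⟩ := nonempty_interior_of_iUnion_of_closed hF hU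
  exact ⟨_, isOpen_interior, hm, m, fun p hp q hq y hy => interior_subset hy p hp q hq⟩

variable {ι 𝕜 : Type*} [RCLike 𝕜]

theorem summable_mul_of_norm_le {e y : ι → 𝕜} {C : ℝ} (he : Summable fun k => ‖e k‖)
    (hy : ∀ k, ‖y k‖ ≤ C) : Summable fun k => e k * y k :=
  .of_norm_bounded (he.mul_right C) fun k => norm_mul_le_of_le le_rfl (hy k)

theorem norm_tsum_mul_le {e y : ι → 𝕜} {C : ℝ} (he : Summable fun k => ‖e k‖)
    (hy : ∀ k, ‖y k‖ ≤ C) : ‖∑' k, e k * y k‖ ≤ (∑' k, ‖e k‖) * C :=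
  tsum_of_norm_bounded (he.hasSum.mul_right C) fun k => norm_mul_le_of_le le_rfl (hy k)

theorem exists_norm_eq_one_mul_eq_norm (z : 𝕜) : ∃ u : 𝕜, ‖u‖ = 1 ∧ z * u = (‖z‖ : 𝕜) := by
  obtain ⟨u, hu, h⟩ := RCLike.exists_norm_eq_mul_self z
  exact ⟨u, hu, by rw [h, mul_comm]⟩

theorem tsum_norm_le_of_forall_eqOn {e y₀ : ι → 𝕜} {I : Finset ι} {ε : ℝ}
    (he : Summable fun k => ‖e k‖) (hy₀ : ∀ k, ‖y₀ k‖ ≤ 1)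
    (h : ∀ y : ι → 𝕜, (∀ k, ‖y k‖ ≤ 1) → EqOn y y₀ I → ‖∑' k, e k * y k‖ ≤ ε) :
    ∑' k, ‖e k‖ ≤ ∑ k ∈ I, ‖e k‖ + ε := by
  classical
  choose u hu hue using fun k => exists_norm_eq_one_mul_eq_norm (e k)
  let y (σ : 𝕜) (k : ι) : 𝕜 := if k ∈ I then y₀ k else σ * u k
  have hy {σ : 𝕜} (hσ : ‖σ‖ = 1) (k : ι) : ‖y σ k‖ ≤ 1 := by
    simp only [y]
    split_ifs
    · exact hy₀ k
    · rw [norm_mul, hσ, hu, one_mul]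
  have pairing_le {σ : 𝕜} (hσ : ‖σ‖ = 1) : ‖∑' k, e k * y σ k‖ ≤ ε :=
    h _ (hy hσ) fun k hk => if_pos hk
  set T : ℝ := ∑' k : ↥((I : Set ι)ᶜ), ‖e k‖ with hT
  have pairing_eq {σ : 𝕜} (hσ : ‖σ‖ = 1) :
      ∑' k, e k * y σ k = ∑ k ∈ I, e k * y₀ k + σ * T := by
    rw [← (summable_mul_of_norm_le he (hy hσ)).sum_add_tsum_compl (s := I), hT, RCLike.ofReal_tsum,
      ← tsum_mul_left]
    congr 1
    · exact Finset.sum_congr rfl fun k hk => by simp only [y, if_pos hk]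
    · refine tsum_congr fun k => ?_
      simp only [y, if_neg (Finset.mem_coe.not.mp k.2), ← hue]
      ring
  have hT₀ : 0 ≤ T := tsum_nonneg fun _ => norm_nonneg _
  have two_mul_le : 2 * T ≤ ε + ε :=
    calc 2 * T = ‖((2 * T : ℝ) : 𝕜)‖ := by
          rw [RCLike.norm_ofReal, abs_of_nonneg (mul_nonneg zero_le_two hT₀)]
      _ = ‖∑' k, e k * y 1 k - ∑' k, e k * y (-1) k‖ := by
        rw [pairing_eq norm_one, pairing_eq (by rw [norm_neg, norm_one])]
        push_cast
        ring_nf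
      _ ≤ ε + ε :=
        norm_sub_le_of_le (pairing_le norm_one) (pairing_le (by rw [norm_neg, norm_one]))
  rw [← he.sum_add_tsum_compl (s := I)]
  linarith

end AbsolutelySummable

section MatrixTransformation

variable {𝕜 : Type*} [RCLike 𝕜]

theorem c0_subset_c : c0 𝕜 ⊆ c 𝕜 := fun _ hy => ⟨0, hy⟩

theorem c_subset_linf : c 𝕜 ⊆ linf 𝕜 := fun _ ⟨_, hl⟩ => hl.norm.bddAbove_range

theorem mem_linf_iff {y : ℕ → 𝕜} : y ∈ linf 𝕜 ↔ ∃ C, ∀ k, ‖y k‖ ≤ C := by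
  simp only [linf, BddAbove, Set.Nonempty, upperBounds, Set.forall_mem_range, Set.mem_ofPred_eq]

/-- The matrix transformation defined by an infinite matrix `A`; where the series does not converge
unconditionally, its value is the junk value `0`. -/
noncomputable def matrixTransform (A : ℕ → ℕ → 𝕜) (y : ℕ → 𝕜) (n : ℕ) : 𝕜 := ∑' k, A n k * y k

open scoped ZeroAtInfty

/-- The functional `y ↦ ∑ₖ e k * y k` on the Banach space of null sequences. -/
noncomputable def nullPairing {e : ℕ → 𝕜} (he : Summable fun k => ‖e k‖) :
    C₀(ℕ, 𝕜) →L[𝕜] 𝕜 :=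
  LinearMap.mkContinuous
    { toFun := fun y => ∑' k, e k * y k
      map_add' := fun y z => by
        simp only [ZeroAtInftyContinuousMap.add_apply, mul_add]
        exact (summable_mul_of_norm_le he y.toBCF.norm_coe_le_norm).tsum_add
          (summable_mul_of_norm_le he z.toBCF.norm_coe_le_norm)
      map_smul' := fun b y => by simp [mul_left_comm, tsum_mul_left] }
    (∑' k, ‖e k‖) fun y => norm_tsum_mul_le he y.toBCF.norm_coe_le_norm

theorem tsum_norm_le_norm_nullPairing {e : ℕ → 𝕜} (he : Summable fun k => ‖e k‖) :
    ∑' k, ‖e k‖ ≤ ‖nullPairing he‖ := by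
  refine Real.tsum_le_of_sum_le (fun _ => norm_nonneg _) fun S => ?_
  choose u hu hue using fun k => exists_norm_eq_one_mul_eq_norm (e k)
  let y : C₀(ℕ, 𝕜) :=
    { toFun := fun k => if k ∈ S then u k else 0
      continuous_toFun := continuous_of_discreteTopology
      zero_at_infty' := by
        rw [cocompact_eq_cofinite]
        exact tendsto_const_nhds.congr' (S.eventually_cofinite_notMem.mono fun k hk =>
          (if_neg hk).symm) }
  have hy : ‖y‖ ≤ 1 := (BoundedContinuousFunction.norm_le zero_le_one).2 fun k => by
    change ‖if k ∈ S then u k else 0‖ ≤ 1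
    split_ifs
    · exact (hu k).le
    · simp
  have pairing_eq : nullPairing he y = ((∑ k ∈ S, ‖e k‖ : ℝ) : 𝕜) := by
    change ∑' k, e k * (if k ∈ S then u k else 0) = _
    rw [tsum_eq_sum fun k hk => by rw [if_neg hk, mul_zero]]
    push_cast
    exact Finset.sum_congr rfl fun k hk => by rw [if_pos hk, hue]
  calc ∑ k ∈ S, ‖e k‖ = ‖nullPairing he y‖ := by
        rw [pairing_eq, RCLike.norm_ofReal, abs_of_nonneg (by positivity)]
    _ ≤ ‖nullPairing he‖ := ContinuousLinearMap.unit_le_opNorm _ _ hy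

variable {A : ℕ → ℕ → 𝕜} {R : ℕ → 𝕜}

theorem bddAbove_tsum_norm_of_mapsTo_c0 (hA : ∀ n, Summable fun k => ‖A n k‖)
    (h : MapsTo (matrixTransform A) (c0 𝕜) (c 𝕜)) :
    BddAbove (range fun n => ∑' k, ‖A n k‖) := by
  obtain ⟨C, hC⟩ := banach_steinhaus (g := fun n => nullPairing (hA n)) fun y => by
    have hy : ⇑y ∈ c0 𝕜 := by simpa only [cocompact_eq_atTop] using! y.zero_at_infty'
    exact mem_linf_iff.1 (c_subset_linf (h hy))
  exact ⟨C, forall_mem_range.2 fun n => (tsum_norm_le_norm_nullPairing (hA n)).trans (hC n)⟩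

theorem exists_tendsto_col_of_mapsTo_c0 (h : MapsTo (matrixTransform A) (c0 𝕜) (c 𝕜)) :
    ∃ R : ℕ → 𝕜, ∀ k, Tendsto (fun n => A n k) atTop (𝓝 (R k)) := by
  refine Classical.axiomOfChoice (r := fun k l => Tendsto (fun n => A n k) atTop (𝓝 l))
    fun k => ?_
  have single_mem : Pi.single k 1 ∈ c0 𝕜 := tendsto_const_nhds.congr' (by
    filter_upwards [eventually_gt_atTop k] with n hn
    rw [Pi.single_eq_of_ne hn.ne'])
  obtain ⟨l, hl⟩ := h single_mem
  refine ⟨l, hl.congr fun n => ?_⟩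
  rw [matrixTransform, tsum_eq_single k fun j hj => by rw [Pi.single_eq_of_ne hj, mul_zero],
    Pi.single_eq_same, mul_one]

theorem summable_norm_of_tendsto_col (hA : ∀ n, Summable fun k => ‖A n k‖)
    (hbdd : BddAbove (range fun n => ∑' k, ‖A n k‖))
    (hR : ∀ k, Tendsto (fun n => A n k) atTop (𝓝 (R k))) : Summable fun k => ‖R k‖ := by
  obtain ⟨C, hC⟩ := hbdd
  exact (summable_and_tsum_norm_le_of_tendsto hA hR (.of_forall fun n => hC ⟨n, rfl⟩)
    tendsto_const_nhds).1

theorem tendsto_matrixTransform_of_mem_c0 (hA : ∀ n, Summable fun k => ‖A n k‖)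
    (hbdd : BddAbove (range fun n => ∑' k, ‖A n k‖))
    (hR : ∀ k, Tendsto (fun n => A n k) atTop (𝓝 (R k))) {y : ℕ → 𝕜} (hy : y ∈ c0 𝕜) :
    Tendsto (matrixTransform A y) atTop (𝓝 (∑' k, R k * y k)) := by
  obtain ⟨Cy, hCy⟩ := mem_linf_iff.1 (c_subset_linf (c0_subset_c hy))
  have hRy := summable_mul_of_norm_le (summable_norm_of_tendsto_col hA hbdd hR) hCy
  obtain ⟨C, hC⟩ := hbdd
  have hC₀ : 0 ≤ C := (tsum_nonneg fun _ => norm_nonneg _).trans (hC ⟨0, rfl⟩)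
  have hunif : TendstoUniformly (fun K n => ∑ k ∈ Finset.range K, A n k * y k)
      (matrixTransform A y) atTop := by
    refine Metric.tendstoUniformly_iff.2 fun ε hε => ?_
    obtain ⟨K₀, hK₀⟩ := Metric.tendsto_atTop.1 hy (ε / (C + 1)) (by positivity)
    filter_upwards [eventually_ge_atTop K₀] with K hK n
    have tail_le : ∑' k, ‖A n (k + K)‖ ≤ C :=
      (tsum_comp_le_tsum_of_inj (hA n) (fun _ => norm_nonneg _) (add_left_injective K)).trans
        (hC ⟨n, rfl⟩)
    rw [dist_eq_norm, matrixTransform,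
      ← (summable_mul_of_norm_le (hA n) hCy).sum_add_tsum_nat_add K, add_sub_cancel_left]
    calc ‖∑' k, A n (k + K) * y (k + K)‖
        ≤ (∑' k, ‖A n (k + K)‖) * (ε / (C + 1)) :=
          norm_tsum_mul_le ((summable_nat_add_iff K).2 (hA n)) fun k => by
            simpa only [dist_zero_right] using (hK₀ (k + K) (by omega)).le
      _ ≤ C * (ε / (C + 1)) := by gcongr
      _ < ε := by
        rw [mul_div_assoc', div_lt_iff₀ (by positivity)]
        linarith
  exact hunif.tendsto_of_eventually_tendsto
    (.of_forall fun K => tendsto_finsetSum _ fun k _ => (hR k).mul_const (y k))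
    hRy.hasSum.tendsto_sum_nat

theorem mapsTo_c0_c_iff (hA : ∀ n, Summable fun k => ‖A n k‖) :
    MapsTo (matrixTransform A) (c0 𝕜) (c 𝕜) ↔
      BddAbove (range fun n => ∑' k, ‖A n k‖) ∧ ∀ k, (fun n => A n k) ∈ c 𝕜 := by
  constructor
  · intro h
    obtain ⟨R, hR⟩ := exists_tendsto_col_of_mapsTo_c0 h
    exact ⟨bddAbove_tsum_norm_of_mapsTo_c0 hA h, fun k => ⟨R k, hR k⟩⟩
  · rintro ⟨hbdd, hcol⟩ y hy
    choose R hR using hcol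
    exact ⟨_, tendsto_matrixTransform_of_mem_c0 hA hbdd hR hy⟩

/-- The Kojima–Schur theorem. -/
theorem mapsTo_c_c_iff (hA : ∀ n, Summable fun k => ‖A n k‖) :
    MapsTo (matrixTransform A) (c 𝕜) (c 𝕜) ↔
      BddAbove (range fun n => ∑' k, ‖A n k‖) ∧ (∀ k, (fun n => A n k) ∈ c 𝕜) ∧
        (fun n => ∑' k, A n k) ∈ c 𝕜 := by
  rw [← and_assoc, ← mapsTo_c0_c_iff hA]
  constructor
  · intro h
    refine ⟨h.mono_left c0_subset_c, ?_⟩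
    have one_mem : (fun _ => 1) ∈ c 𝕜 := ⟨1, tendsto_const_nhds⟩
    obtain ⟨l, hl⟩ := h one_mem
    exact ⟨l, hl.congr fun n => by simp only [matrixTransform, mul_one]⟩
  · rintro ⟨h, l, hl⟩ y ⟨p, hp⟩
    have sub_mem : (fun k => y k - p) ∈ c0 𝕜 := tendsto_sub_nhds_zero_iff.2 hp
    obtain ⟨l₀, hl₀⟩ := h sub_mem
    refine ⟨l₀ + l * p, (hl₀.add (hl.mul_const p)).congr fun n => ?_⟩
    obtain ⟨C, hC⟩ := mem_linf_iff.1 (c_subset_linf (c0_subset_c sub_mem))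
    rw [matrixTransform, matrixTransform, ← tsum_mul_right,
      ← (summable_mul_of_norm_le (hA n) hC).tsum_add ((hA n).of_norm.mul_right p)]
    simp only [← mul_add, sub_add_cancel]

theorem exists_tsum_norm_sub_le_of_mapsTo_linf (hA : ∀ n, Summable fun k => ‖A n k‖)
    (h : MapsTo (matrixTransform A) (linf 𝕜) (c 𝕜)) {ε : ℝ} (hε : 0 < ε) :
    ∃ (I : Finset ℕ) (m : ℕ), ∀ p ≥ m, ∀ q ≥ m,
      ∑' k, ‖A p k - A q k‖ ≤ ∑ k ∈ I, ‖A p k - A q k‖ + ε := by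
  -- The product of unit balls carries the product topology, in which it is compact.
  let f : ℕ → (ℕ → Metric.closedBall (0 : 𝕜) 1) → 𝕜 := fun n y => matrixTransform A (fun k => y k) n
  have hball (y : ℕ → Metric.closedBall (0 : 𝕜) 1) (k : ℕ) : ‖(y k : 𝕜)‖ ≤ 1 :=
    mem_closedBall_zero_iff.mp (y k).2
  have hf (n : ℕ) : Continuous (f n) :=
    continuous_tsum (by fun_prop) (hA n) fun k y =>
      (norm_mul_le_of_le le_rfl (hball y k)).trans_eq (mul_one _)
  obtain ⟨U, hUo, ⟨y₀, hy₀⟩, m, hm⟩ := exists_isOpen_forall_dist_le_of_cauchySeq hf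
    (fun y => by
      obtain ⟨l, hl⟩ := h (mem_linf_iff.2 ⟨1, hball y⟩)
      exact hl.cauchySeq) hε
  obtain ⟨I, u, hu, hIU⟩ := isOpen_pi_iff.mp hUo y₀ hy₀
  refine ⟨I, m, fun p hp q hq => ?_⟩
  refine tsum_norm_le_of_forall_eqOn ((hA p).of_norm.sub (hA q).of_norm).norm (hball y₀)
    fun y hy hyI => ?_
  have hyU : (fun k => ⟨y k, mem_closedBall_zero_iff.mpr (hy k)⟩) ∈ U := hIU fun k hk => by
    convert (hu k hk).2
    exact hyI hk
  simpa only [f, matrixTransform, dist_eq_norm, sub_mul,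
    ← (summable_mul_of_norm_le (hA p) hy).tsum_sub (summable_mul_of_norm_le (hA q) hy)]
    using hm p hp q hq _ hyU

theorem tendsto_tsum_norm_sub_of_mapsTo_linf (hA : ∀ n, Summable fun k => ‖A n k‖)
    (hR : ∀ k, Tendsto (fun n => A n k) atTop (𝓝 (R k)))
    (h : MapsTo (matrixTransform A) (linf 𝕜) (c 𝕜)) :
    Tendsto (fun n => ∑' k, ‖A n k - R k‖) atTop (𝓝 0) := by
  refine tendsto_order.2 ⟨fun b hb => .of_forall fun n => hb.trans_le
    (tsum_nonneg fun _ => norm_nonneg _), fun ε hε => ?_⟩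
  obtain ⟨I, m, hm⟩ := exists_tsum_norm_sub_le_of_mapsTo_linf hA h (half_pos hε)
  have tsum_le (p : ℕ) (hp : m ≤ p) :
      ∑' k, ‖A p k - R k‖ ≤ ∑ k ∈ I, ‖A p k - R k‖ + ε / 2 :=
    (summable_and_tsum_norm_le_of_tendsto (F := atTop)
      (fun q => ((hA p).of_norm.sub (hA q).of_norm).norm)
      (fun k => (hR k).const_sub (A p k))
      (eventually_atTop.2 ⟨m, fun q hq => hm p hp q hq⟩)
      ((tendsto_finsetSum I fun k _ => ((hR k).const_sub (A p k)).norm).add_const (ε / 2))).2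
  have tendsto_head : Tendsto (fun n => ∑ k ∈ I, ‖A n k - R k‖) atTop (𝓝 0) := by
    simpa using tendsto_finsetSum I fun k _ => ((hR k).sub_const (R k)).norm
  filter_upwards [eventually_ge_atTop m, tendsto_head.eventually_lt_const (half_pos hε)]
    with n hn hlt
  linarith [tsum_le n hn]

/-- Schur's theorem. -/
theorem mapsTo_linf_c_iff (hA : ∀ n, Summable fun k => ‖A n k‖)
    (hR : ∀ k, Tendsto (fun n => A n k) atTop (𝓝 (R k))) :
    MapsTo (matrixTransform A) (linf 𝕜) (c 𝕜) ↔
      (Summable fun k => ‖R k‖) ∧ Tendsto (fun n => ∑' k, ‖A n k - R k‖) atTop (𝓝 0) := by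
  constructor
  · intro h
    have h₀ := h.mono_left (c0_subset_c.trans c_subset_linf)
    exact ⟨summable_norm_of_tendsto_col hA (bddAbove_tsum_norm_of_mapsTo_c0 hA h₀) hR,
      tendsto_tsum_norm_sub_of_mapsTo_linf hA hR h⟩
  · rintro ⟨hRs, hlim⟩ y hy
    obtain ⟨C, hC⟩ := mem_linf_iff.1 hy
    refine ⟨∑' k, R k * y k, tendsto_sub_nhds_zero_iff.1 ?_⟩
    refine squeeze_zero_norm (fun n => ?_) (by simpa only [zero_mul] using hlim.mul_const C)
    rw [matrixTransform, ← (summable_mul_of_norm_le (hA n) hC).tsum_sub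
      (summable_mul_of_norm_le hRs hC)]
    simp only [← sub_mul]
    exact norm_tsum_mul_le ((hA n).of_norm.sub hRs.of_norm).norm hC

end MatrixTransformation

section Triangular

variable {𝕜 : Type*} [RCLike 𝕜] {A : ℕ → ℕ → 𝕜} {R : ℕ → 𝕜} {X : Set (ℕ → 𝕜)}

theorem tsum_eq_sum_range_succ {E : Type*} [AddCommMonoid E] [TopologicalSpace E] {u : ℕ → E}
    {m : ℕ} (hu : ∀ k, m < k → u k = 0) : ∑' k, u k = ∑ k ∈ range (m + 1), u k :=
  tsum_eq_sum fun k hk => hu k (by simpa using hk)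

theorem summable_norm_of_triangular (hA : ∀ m k, m < k → A m k = 0) (m : ℕ) :
    Summable fun k => ‖A m k‖ :=
  summable_of_ne_finset_zero (s := range (m + 1)) fun k hk => by
    rw [hA m k (by simpa using hk), norm_zero]

theorem mem_c_iff_of_add_mem_c {x y : ℕ → 𝕜} (h : (fun n => x n + y n) ∈ c 𝕜) :
    x ∈ c 𝕜 ↔ y ∈ c 𝕜 := by
  obtain ⟨l, hl⟩ := h
  constructor
  · rintro ⟨p, hp⟩
    exact ⟨l - p, by simpa only [add_sub_cancel_left] using hl.sub hp⟩
  · rintro ⟨p, hp⟩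
    exact ⟨l - p, by simpa only [add_sub_cancel_right] using hl.sub hp⟩

/-- The triangular matrix of the differences `R k - A m k`, `k ≤ m`, between the rows of `A` and a
sequence `R`, usually the limit of the rows. -/
def remainder (A : ℕ → ℕ → 𝕜) (R : ℕ → 𝕜) (m k : ℕ) : 𝕜 := if k ≤ m then R k - A m k else 0

theorem remainder_of_le {m k : ℕ} (h : k ≤ m) : remainder A R m k = R k - A m k := if_pos h

theorem remainder_of_lt {m k : ℕ} (h : m < k) : remainder A R m k = 0 := if_neg h.not_ge

theorem mapsTo_c_iff_mapsTo_remainder (hA : ∀ m k, m < k → A m k = 0) (hX : X ⊆ linf 𝕜)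
    (hR : Summable fun k => ‖R k‖) :
    MapsTo (matrixTransform A) X (c 𝕜) ↔ MapsTo (matrixTransform (remainder A R)) X (c 𝕜) := by
  refine forall₂_congr fun y hy => mem_c_iff_of_add_mem_c ?_
  obtain ⟨C, hC⟩ := mem_linf_iff.1 (hX hy)
  refine ⟨∑' k, R k * y k, ((tendsto_add_atTop_iff_nat 1).2
    (summable_mul_of_norm_le hR hC).hasSum.tendsto_sum_nat).congr fun m => ?_⟩
  rw [matrixTransform, matrixTransform,
    tsum_eq_sum_range_succ fun k hk => by rw [hA m k hk, zero_mul],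
    tsum_eq_sum_range_succ fun k hk => by rw [remainder_of_lt hk, zero_mul], ← sum_add_distrib]
  refine sum_congr rfl fun k hk => ?_
  rw [remainder_of_le (Nat.lt_succ_iff.mp (Finset.mem_range.mp hk)), ← add_mul, add_sub_cancel]

theorem mapsTo_c_iff_exists_mapsTo_remainder (hA : ∀ m k, m < k → A m k = 0) (h₀ : c0 𝕜 ⊆ X)
    (h₁ : X ⊆ linf 𝕜) :
    MapsTo (matrixTransform A) X (c 𝕜) ↔
      ∃ R : ℕ → 𝕜, (∀ k, Tendsto (fun m => A m k) atTop (𝓝 (R k))) ∧ (Summable fun k => ‖R k‖) ∧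
        MapsTo (matrixTransform (remainder A R)) X (c 𝕜) := by
  constructor
  · intro h
    have hsum := summable_norm_of_triangular hA
    obtain ⟨R, hR⟩ := exists_tendsto_col_of_mapsTo_c0 (h.mono_left h₀)
    have hRs := summable_norm_of_tendsto_col hsum
      (bddAbove_tsum_norm_of_mapsTo_c0 hsum (h.mono_left h₀)) hR
    exact ⟨R, hR, hRs, (mapsTo_c_iff_mapsTo_remainder hA h₁ hRs).1 h⟩
  · rintro ⟨R, -, hRs, h⟩
    exact (mapsTo_c_iff_mapsTo_remainder hA h₁ hRs).2 h

end Triangular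

section BetaDual

variable {𝕜 : Type*} [RCLike 𝕜] {r s t a : ℕ → 𝕜}

/-- The matrix that takes the mean `y = genMean r s t (diff x)` of a sequence `x` to the partial
sums of `∑ a n * x n`; its row `N` belongs to the sum over `n < N`. -/
noncomputable def partialSumMatrix (r s t a : ℕ → 𝕜) (N k : ℕ) : 𝕜 :=
  ∑ n ∈ Finset.Ico k N, a n * invMeanMatrix r s t n k

theorem partialSumMatrix_of_le {N k : ℕ} (h : N ≤ k) : partialSumMatrix r s t a N k = 0 := by
  rw [partialSumMatrix, Finset.Ico_eq_empty_of_le h, sum_empty]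

theorem sum_mul_invMean_eq_matrixTransform (y : ℕ → 𝕜) (N : ℕ) :
    ∑ n ∈ range N, a n * invMean r s t y n =
      matrixTransform (partialSumMatrix r s t a) y N := by
  rw [matrixTransform, tsum_eq_sum (s := range N) fun k hk => by
    rw [partialSumMatrix_of_le (by simpa using hk), zero_mul]]
  simp only [invMean, partialSumMatrix, mul_sum, sum_mul]
  rw [Finset.sum_comm' (t' := range N) (s' := fun k => Finset.Ico k N)
    (by intro n k; simp only [Finset.mem_range, Finset.mem_Ico]; omega)]
  simp only [mul_assoc]

theorem mem_betaDual_space_iff_mapsTo (hr : ∀ n, r n ≠ 0) (hs : s 0 ≠ 0) (ht : ∀ n, t n ≠ 0)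
    {X : Set (ℕ → 𝕜)} :
    a ∈ betaDual (space X r s t) ↔
      MapsTo (matrixTransform (partialSumMatrix r s t a)) X (c 𝕜) := by
  have space_eq : space X r s t = invMean r s t '' X := by
    ext x
    simp only [space, Set.mem_ofPred_eq, Set.mem_image, ← genMean_diff_eq_iff hr hs ht,
      eq_comm (b := x), exists_eq_right']
  rw [space_eq, betaDual, multiplier, Set.mem_ofPred_eq, Set.forall_mem_image]
  simp only [MapsTo, cs, c, Set.mem_ofPred_eq, sum_mul_invMean_eq_matrixTransform]

theorem wTrunc_eq_sub {m k M : ℕ} (hk : k ≤ m) (hM : m ≤ M) :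
    wTrunc r s t a m k M =
      partialSumMatrix r s t a (M + 1) k - partialSumMatrix r s t a m k := by
  have split_entry : ∀ n ∈ Finset.Ico m (M + 1), a n * invMeanMatrix r s t n k = r k *
      ((∑ l ∈ Finset.Icc 0 (m - k), (-1) ^ l * (D s l / t (l + k))) * a n +
        ∑ l ∈ Finset.Icc (m - k + 1) (n - k), (-1) ^ l * (D s l / t (l + k)) * a n) := by
    intro n hn
    have hle : m - k + 1 ≤ n - k + 1 := by
      have := (Finset.mem_Ico.mp hn).1
      omega
    rw [invMeanMatrix, ← sum_mul, ← add_mul]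
    simp only [← Finset.Ico_add_one_right_eq_Icc]
    rw [sum_Ico_consecutive _ (Nat.zero_le _) hle]
    ring
  rw [partialSumMatrix, partialSumMatrix,
    sub_eq_of_eq_add' (sum_Ico_consecutive _ hk (Nat.le_succ_of_le hM)).symm, wTrunc,
    sum_congr rfl split_entry, ← mul_sum, sum_add_distrib, ← mul_sum,
    Finset.sum_comm' (t' := Finset.Icc (m - k + 1) (M - k)) (s' := fun l => Finset.Icc (k + l) M)
      (by intro n l; simp only [Finset.mem_Icc, Finset.mem_Ico]; omega)]
  simp only [mul_sum, Finset.Ico_add_one_right_eq_Icc]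

theorem RTrunc_eq_wTrunc {k M : ℕ} (hM : k ≤ M) : RTrunc r s t a k M = wTrunc r s t a k k M := by
  have diagonal_term : D s 0 / t k * a k = a k / (s 0 * t k) := by
    simp only [D, hessenberg, Matrix.det_fin_zero, zero_add, pow_one, mul_one]
    ring
  rw [RTrunc, wTrunc, ← add_sum_Ioc_eq_sum_Icc hM, ← Finset.Icc_add_one_left_eq_Ioc, Nat.sub_self]
  rcases Nat.eq_or_lt_of_le hM with rfl | hlt
  · simp [diagonal_term]
  · rw [← add_sum_Ioc_eq_sum_Icc (a := 0 + 1) (b := M - k) (by omega),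
      ← Finset.Icc_add_one_left_eq_Ioc]
    simp only [add_comm 1 k, Finset.Icc_self, sum_singleton, pow_zero, pow_one, zero_add, one_mul,
      mul_add, diagonal_term]
    ring_nf

theorem isR_iff {R : ℕ → 𝕜} :
    IsR r s t a R ↔
      ∀ k, Tendsto (fun N => partialSumMatrix r s t a N k) atTop (𝓝 (R k)) := by
  refine forall_congr' fun k => ?_
  rw [← tendsto_add_atTop_iff_nat (f := fun N => partialSumMatrix r s t a N k) 1]
  refine tendsto_congr' ?_
  filter_upwards [eventually_ge_atTop k] with M hM
  rw [RTrunc_eq_wTrunc hM, wTrunc_eq_sub le_rfl hM, partialSumMatrix_of_le le_rfl, sub_zero]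

theorem IsR.isW_remainder {R : ℕ → 𝕜} (hR : IsR r s t a R) :
    IsW r s t a (remainder (partialSumMatrix r s t a) R) := by
  refine ⟨fun m k hk => ?_, fun m k => remainder_of_lt⟩
  rw [remainder_of_le hk]
  refine (((tendsto_add_atTop_iff_nat 1).2 (isR_iff.1 hR k)).sub_const _).congr' ?_
  filter_upwards [eventually_ge_atTop m] with M hM
  exact (wTrunc_eq_sub hk hM).symm

theorem IsW.eq {w w' : ℕ → ℕ → 𝕜} (hw : IsW r s t a w) (hw' : IsW r s t a w') : w = w' := by
  ext m k
  rcases le_or_gt k m with hk | hk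
  · exact tendsto_nhds_unique (hw.1 m k hk) (hw'.1 m k hk)
  · rw [hw.2 m k hk, hw'.2 m k hk]

theorem IsW.isR {w : ℕ → ℕ → 𝕜} (hw : IsW r s t a w) : IsR r s t a fun k => w k k := fun k =>
  (hw.1 k k le_rfl).congr' <| by
    filter_upwards [eventually_ge_atTop k] with M hM
    exact (RTrunc_eq_wTrunc hM).symm

theorem IsW.tendsto_col {w : ℕ → ℕ → 𝕜} (hw : IsW r s t a w) (k : ℕ) :
    Tendsto (fun m => w m k) atTop (𝓝 0) := by
  rw [hw.eq hw.isR.isW_remainder]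
  have sub_tendsto := (isR_iff.1 hw.isR k).const_sub (w k k)
  rw [sub_self] at sub_tendsto
  refine sub_tendsto.congr' ?_
  filter_upwards [eventually_ge_atTop k] with m hm
  exact (remainder_of_le hm).symm

theorem exists_isW_and_and {P Q : (ℕ → ℕ → 𝕜) → Prop} :
    (∃ w, IsW r s t a w ∧ P w ∧ Q w) ↔
      (∃ w, IsW r s t a w ∧ P w) ∧ ∃ w, IsW r s t a w ∧ Q w := by
  constructor
  · rintro ⟨w, hw, hP, hQ⟩
    exact ⟨⟨w, hw, hP⟩, w, hw, hQ⟩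
  · rintro ⟨⟨w, hw, hP⟩, w', hw', hQ⟩
    exact ⟨w, hw, hP, hw'.eq hw ▸ hQ⟩

theorem betaDual_space_eq (hr : ∀ n, r n ≠ 0) (hs : s 0 ≠ 0) (ht : ∀ n, t n ≠ 0)
    {X : Set (ℕ → 𝕜)} (h₀ : c0 𝕜 ⊆ X) (h₁ : X ⊆ linf 𝕜) :
    betaDual (space X r s t) =
      B₁ r s t ∩ {a | ∃ w, IsW r s t a w ∧ MapsTo (matrixTransform w) X (c 𝕜)} := by
  ext a
  rw [mem_betaDual_space_iff_mapsTo hr hs ht, mapsTo_c_iff_exists_mapsTo_remainder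
    (fun N k h => partialSumMatrix_of_le h.le) h₀ h₁]
  simp only [← isR_iff]
  constructor
  · rintro ⟨R, hR, hRs, h⟩
    exact ⟨⟨R, hR, hRs⟩, _, hR.isW_remainder, h⟩
  · rintro ⟨⟨R, hR, hRs⟩, w, hw, h⟩
    exact ⟨R, hR, hRs, hw.eq hR.isW_remainder ▸ h⟩

theorem setOf_mapsTo_c0_c_eq :
    {a | ∃ w, IsW r s t a w ∧ MapsTo (matrixTransform w) (c0 𝕜) (c 𝕜)} =
      B₂ r s t ∩ B₃ r s t := by
  ext a
  refine Iff.trans (exists_congr fun w => and_congr_right fun hw => ?_) exists_isW_and_and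
  rw [mapsTo_c0_c_iff (summable_norm_of_triangular hw.2), and_comm]
  exact and_congr_left' (iff_of_true (fun k => ⟨0, hw.tendsto_col k⟩) hw.tendsto_col)

theorem setOf_mapsTo_linf_c_eq :
    {a | ∃ w, IsW r s t a w ∧ MapsTo (matrixTransform w) (linf 𝕜) (c 𝕜)} = B₄ r s t := by
  ext a
  refine exists_congr fun w => and_congr_right fun hw => ?_
  rw [mapsTo_linf_c_iff (summable_norm_of_triangular hw.2) hw.tendsto_col]
  simp only [norm_zero, summable_zero, true_and, sub_zero]
  refine tendsto_congr fun m => tsum_eq_sum_range_succ fun k hk => ?_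
  rw [hw.2 m k hk, norm_zero]

theorem setOf_mapsTo_c_c_eq :
    {a | ∃ w, IsW r s t a w ∧ MapsTo (matrixTransform w) (c 𝕜) (c 𝕜)} =
      B₃ r s t ∩ (B₅ r s t ∩ B₆ r s t) := by
  ext a
  refine Iff.trans (exists_congr fun w => and_congr_right fun hw => ?_)
    (exists_isW_and_and.trans (and_congr_right' exists_isW_and_and))
  rw [mapsTo_c_c_iff (summable_norm_of_triangular hw.2)]
  simp only [tsum_eq_sum_range_succ (hw.2 _)]
  rfl

end BetaDual

end GenMeans

theorem theorem4p8 {𝕜 : Type*} [RCLike 𝕜] (r s t : ℕ → 𝕜)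
    (hr : ∀ n, r n ≠ 0) (hs : s 0 ≠ 0) (ht : ∀ n, t n ≠ 0) :
    GenMeans.betaDual (GenMeans.space (GenMeans.c0 𝕜) r s t) =
        GenMeans.B₁ r s t ∩ GenMeans.B₂ r s t ∩ GenMeans.B₃ r s t ∧
      GenMeans.betaDual (GenMeans.space (GenMeans.linf 𝕜) r s t) =
        GenMeans.B₁ r s t ∩ GenMeans.B₄ r s t ∧
      GenMeans.betaDual (GenMeans.space (GenMeans.c 𝕜) r s t) =
        GenMeans.B₁ r s t ∩ GenMeans.B₃ r s t ∩ GenMeans.B₅ r s t ∩ GenMeans.B₆ r s t := by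
  open GenMeans in
  refine ⟨?_, ?_, ?_⟩
  · rw [betaDual_space_eq hr hs ht subset_rfl (c0_subset_c.trans c_subset_linf),
      setOf_mapsTo_c0_c_eq, Set.inter_assoc]
  · rw [betaDual_space_eq hr hs ht (c0_subset_c.trans c_subset_linf) subset_rfl,
      setOf_mapsTo_linf_c_eq]
  · rw [betaDual_space_eq hr hs ht c0_subset_c c_subset_linf, setOf_mapsTo_c_c_eq,
      Set.inter_assoc, Set.inter_assoc]
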